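/- Let $(X,\mathcal B,\mu)$ be a $\sigma$-finite measure space and let $f:X\to X$ be a bijection such that $f(B)\in\mathcal B$ and $f^{-1}(B)\in\mathcal B$ for every $B\in\mathcal B$. Assume that there is $c>0$ with $\mu(f^{-1}(B))\le c\,\mu(B)$ and $\mu(f(B))\le c\,\mu(B)$ for every $B\in\mathcal B$. Let $1\le p<\infty$ and let $L^p(X)=L^p(X,\mathcal B,\mu)$ be the Banach space of real- or complex-valued $p$-integrable functions, so that the composition operator $T_f:L^p(X)\to L^p(X)$, $T_f\varphi=\varphi\circ f$, is a well-defined bounded invertible operator with inverse $T_{f^{-1}}$. Assume that $(X,\mathcal B,\mu,f)$ is a dissipative system of bounded distortion, i.e. there is $W\in\mathcal B$ with $0<\mu(W)<\infty$ such that the sets $f^k(W)$, $k\in\mathbb Z$, are pairwise disjoint with union $X$, and there is $K>0$ such that $$\frac1K\,\mu(f^k(W))\,\mu(B)\le \mu(f^k(B))\,\mu(W)\le K\,\mu(f^k(W))\,\mu(B)$$ for all $k\in\mathbb Z$ and all $B\in\mathcal B$ with $B\subseteq W$. Then the following are equivalent. 1. $T=T_f$ is generalized hyperbolic: there are closed subspaces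 $M,N$ of $L^p(X)$ with $L^p(X)=M\oplus N$, $T(M)\subseteq M$, $T^{-1}(N)\subseteq N$, such that $T|_M:M\to M$ and $T^{-1}|_N:N\to N$ are proper contractions up to passing to an equivalent norm, i.e. have spectral radius less than $1$, where the spectral radius of a bounded operator $S$ is $\lim_{n\to\infty}\|S^n\|^{1/n}$. 2. $T=T_f$ has the shadowing property: for every $\epsilon>0$ there is $\delta>0$ such that for every sequence $(x_n)_{n\in\mathbb Z}$ in $L^p(X)$ with $\|Tx_n-x_{n+1}\|\le\delta$ for all $n\in\mathbb Z$ there is $x\in L^p(X)$ with $\|T^nx-x_n\|<\epsilon$ for all $n\in\mathbb Z$. -/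

import Mathlib

open MeasureTheory Filter Set
open scoped ENNReal NNReal

namespace CompositionDynamics

set_option linter.unusedSectionVars false

/-! ### Linear dynamics on a normed space -/

section LinearDynamics

variable {𝕜 : Type*} [NontriviallyNormedField 𝕜]
  {E : Type*} [NormedAddCommGroup E] [NormedSpace 𝕜 E]

/-- The bi-infinite sequence `x` is a `δ`-pseudotrajectory of `T`. -/
def IsPseudotrajectory (T : E ≃L[𝕜] E) (δ : ℝ) (x : ℤ → E) : Prop :=
  ∀ n : ℤ, ‖T (x n) - x (n + 1)‖ ≤ δ

/-- The shadowing property of an invertible bounded operator: every pseudotrajectory is shadowed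
by a real trajectory. -/
def HasShadowingProperty (T : E ≃L[𝕜] E) : Prop :=
  ∀ ε : ℝ, 0 < ε → ∃ δ : ℝ, 0 < δ ∧ ∀ x : ℤ → E, IsPseudotrajectory T δ x →
    ∃ y : E, ∀ n : ℤ, ‖(T ^ n) y - x n‖ < ε

/-- The spectral radius `lim ‖Sⁿ‖^(1/n)` of a bounded operator (the limit always exists, by
subadditivity; it is written as an upper limit in `[0, ∞]`). The scalars may be real or complex. -/
noncomputable def operatorSpectralRadius (S : E →L[𝕜] E) : ℝ≥0∞ :=
  limsup (fun n : ℕ => (‖S ^ n‖₊ : ℝ≥0∞) ^ (1 / n : ℝ)) atTop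

/-- A bounded operator is a proper contraction (up to passing to an equivalent norm) if its
spectral radius is less than `1`. -/
def IsProperContraction (S : E →L[𝕜] E) : Prop :=
  operatorSpectralRadius S < 1

/-- For complex Banach spaces the spectral radius above is the usual one. -/
theorem operatorSpectralRadius_eq_spectralRadius {F : Type*} [NormedAddCommGroup F]
    [NormedSpace ℂ F] [CompleteSpace F] (S : F →L[ℂ] F) :
    operatorSpectralRadius S = spectralRadius ℂ S :=
  (spectrum.pow_nnnorm_pow_one_div_tendsto_nhds_spectralRadius S).limsup_eq

/-- Generalized hyperbolicity: `E = M ⊕ N` with `M`, `N` closed, `T M ⊆ M`, `T⁻¹ N ⊆ N`, and the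
restrictions `T|_M : M → M` and `T⁻¹|_N : N → N` are proper contractions. -/
def IsGeneralizedHyperbolic (T : E ≃L[𝕜] E) : Prop :=
  ∃ M N : Submodule 𝕜 E, IsClosed (M : Set E) ∧ IsClosed (N : Set E) ∧ IsCompl M N ∧
    ∃ (hM : ∀ x ∈ M, (T : E →L[𝕜] E) x ∈ M) (hN : ∀ x ∈ N, (T.symm : E →L[𝕜] E) x ∈ N),
      IsProperContraction ((T : E →L[𝕜] E).restrict hM) ∧
      IsProperContraction ((T.symm : E →L[𝕜] E).restrict hN)

end LinearDynamics

/-! ### Composition operators and dissipative systems -/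

section Systems

variable {X : Type*} [MeasurableSpace X]

/-- There is `c > 0` with `μ (f⁻¹ B) ≤ c μ B` for all measurable `B`. -/
def HasBoundedPreimages (f : X → X) (μ : Measure X) : Prop :=
  ∃ c : ℝ≥0, 0 < c ∧ ∀ B : Set X, MeasurableSet B → μ (f ⁻¹' B) ≤ c * μ B

/-- The set `f^k (B)`, for an integer `k`. -/
def iterImage (f : X ≃ᵐ X) (k : ℤ) (B : Set X) : Set X :=
  ((f.toEquiv : Equiv.Perm X) ^ k) '' B

/-- `(X, μ, f)` is a dissipative system generated by `W`: `W` is measurable with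
`0 < μ W < ∞`, and `X` is the disjoint union of the sets `f^k (W)`, `k ∈ ℤ`. -/
def IsDissipativeGeneratedBy (μ : Measure X) (f : X ≃ᵐ X) (W : Set X) : Prop :=
  MeasurableSet W ∧ 0 < μ W ∧ μ W < ∞ ∧
    Pairwise (fun j k : ℤ => Disjoint (iterImage f j W) (iterImage f k W)) ∧
    ⋃ k : ℤ, iterImage f k W = univ

/-- `f` is of bounded distortion on `W`. -/
def HasBoundedDistortionOn (μ : Measure X) (f : X ≃ᵐ X) (W : Set X) : Prop :=
  ∃ K : ℝ≥0, 0 < K ∧ ∀ (k : ℤ) (B : Set X), MeasurableSet B → B ⊆ W →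
    (K : ℝ≥0∞)⁻¹ * (μ (iterImage f k W) * μ B) ≤ μ (iterImage f k B) * μ W ∧
    μ (iterImage f k B) * μ W ≤ K * (μ (iterImage f k W) * μ B)

/-- A dissipative system of bounded distortion. -/
def IsDissipativeOfBoundedDistortion (μ : Measure X) (f : X ≃ᵐ X) : Prop :=
  ∃ W : Set X, IsDissipativeGeneratedBy μ f W ∧ HasBoundedDistortionOn μ f W

theorem HasBoundedPreimages.exists_map_le {μ : Measure X} {f : X → X} (hm : Measurable f)
    (hf : HasBoundedPreimages f μ) : ∃ c : ℝ≥0, μ.map f ≤ (c : ℝ≥0∞) • μ := by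
  obtain ⟨c, -, hc⟩ := hf
  refine ⟨c, Measure.le_iff.2 fun B hB => ?_⟩
  rw [Measure.map_apply hm hB]
  simpa using hc B hB

theorem HasBoundedPreimages.quasiMeasurePreserving {μ : Measure X} {f : X → X}
    (hm : Measurable f) (hf : HasBoundedPreimages f μ) :
    Measure.QuasiMeasurePreserving f μ μ :=
  ⟨hm, (hf.exists_map_le hm).elim fun _ h => Measure.absolutelyContinuous_of_le_smul h⟩

theorem HasBoundedPreimages.memLp_comp {μ : Measure X} {f : X → X} (hm : Measurable f)
    (hf : HasBoundedPreimages f μ) {F : Type*} [NormedAddCommGroup F] {p : ℝ≥0∞} {g : X → F}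
    (hg : MemLp g p μ) : MemLp (g ∘ f) p μ := by
  obtain ⟨c, hc⟩ := hf.exists_map_le hm
  exact (hg.of_measure_le_smul ENNReal.coe_ne_top hc).comp_of_map hm.aemeasurable

variable (𝕜 : Type*) [RCLike 𝕜] (p : ℝ≥0∞) [Fact (1 ≤ p)] {μ : Measure X}

/-- `φ ↦ φ ∘ f` as a linear map on `L^p`. -/
noncomputable def compLinearMap (f : X → X) (hm : Measurable f)
    (hf : HasBoundedPreimages f μ) : Lp 𝕜 p μ →ₗ[𝕜] Lp 𝕜 p μ where
  toFun φ := (hf.memLp_comp hm (Lp.memLp φ)).toLp (φ ∘ f)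
  map_add' φ ψ := by
    rw [← MemLp.toLp_add]
    exact MemLp.toLp_congr _ _
      ((hf.quasiMeasurePreserving hm).ae_eq_comp (Lp.coeFn_add φ ψ))
  map_smul' a φ := by
    rw [RingHom.id_apply, ← MemLp.toLp_const_smul]
    exact MemLp.toLp_congr _ _
      ((hf.quasiMeasurePreserving hm).ae_eq_comp (Lp.coeFn_smul a φ))

theorem coeFn_compLinearMap (f : X → X) (hm : Measurable f) (hf : HasBoundedPreimages f μ)
    (φ : Lp 𝕜 p μ) : compLinearMap 𝕜 p f hm hf φ =ᵐ[μ] φ ∘ f :=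
  MemLp.coeFn_toLp (hf.memLp_comp hm (Lp.memLp φ))

theorem exists_bound_compLinearMap (f : X → X) (hm : Measurable f)
    (hf : HasBoundedPreimages f μ) :
    ∃ C : ℝ, ∀ φ : Lp 𝕜 p μ, ‖compLinearMap 𝕜 p f hm hf φ‖ ≤ C * ‖φ‖ := by
  obtain ⟨c, hc⟩ := hf.exists_map_le hm
  refine ⟨((c : ℝ≥0∞) ^ (1 / p).toReal).toReal, fun φ => ?_⟩
  rw [Lp.norm_def, Lp.norm_def, ← ENNReal.toReal_mul]
  refine ENNReal.toReal_mono (ENNReal.mul_ne_top (by simp) (Lp.eLpNorm_ne_top φ)) ?_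
  have hac : μ.map f ≪ μ := Measure.absolutelyContinuous_of_le_smul hc
  rw [eLpNorm_congr_ae (coeFn_compLinearMap 𝕜 p f hm hf φ),
    ← eLpNorm_map_measure ((Lp.aestronglyMeasurable φ).mono_ac hac) hm.aemeasurable]
  exact eLpNorm_le_of_measure_le_smul hc

/-- `φ ↦ φ ∘ f` as a bounded operator on `L^p`. -/
noncomputable def compCLM (f : X → X) (hm : Measurable f)
    (hf : HasBoundedPreimages f μ) : Lp 𝕜 p μ →L[𝕜] Lp 𝕜 p μ :=
  (compLinearMap 𝕜 p f hm hf).mkContinuousOfExistsBound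
    (exists_bound_compLinearMap 𝕜 p f hm hf)

theorem coeFn_compCLM (f : X → X) (hm : Measurable f) (hf : HasBoundedPreimages f μ)
    (φ : Lp 𝕜 p μ) : compCLM 𝕜 p f hm hf φ =ᵐ[μ] φ ∘ f :=
  coeFn_compLinearMap 𝕜 p f hm hf φ

theorem compCLM_leftInverse (f g : X → X) (hm : Measurable f) (hf : HasBoundedPreimages f μ)
    (hm' : Measurable g) (hg : HasBoundedPreimages g μ) (h : f ∘ g = id) :
    Function.LeftInverse (compCLM 𝕜 p g hm' hg) (compCLM 𝕜 p f hm hf) := by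
  intro φ
  refine Lp.ext ((coeFn_compCLM 𝕜 p g hm' hg _).trans ?_)
  refine ((hg.quasiMeasurePreserving hm').ae_eq_comp (coeFn_compCLM 𝕜 p f hm hf φ)).trans ?_
  rw [Function.comp_assoc, h, Function.comp_id]

/-- The composition operator `T_f φ = φ ∘ f` as an invertible bounded operator on `L^p`, with
inverse `φ ↦ φ ∘ f⁻¹`. -/
noncomputable def compositionOperator (f : X ≃ᵐ X) (hf : HasBoundedPreimages f μ)
    (hf' : HasBoundedPreimages f.symm μ) : Lp 𝕜 p μ ≃L[𝕜] Lp 𝕜 p μ :=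
  ContinuousLinearEquiv.equivOfInverse
    (compCLM 𝕜 p f f.measurable hf) (compCLM 𝕜 p f.symm f.symm.measurable hf')
    (compCLM_leftInverse 𝕜 p _ _ _ _ _ _ f.self_comp_symm)
    (compCLM_leftInverse 𝕜 p _ _ _ _ _ _ f.symm_comp_self)

theorem coeFn_compositionOperator (f : X ≃ᵐ X) (hf : HasBoundedPreimages f μ)
    (hf' : HasBoundedPreimages f.symm μ) (φ : Lp 𝕜 p μ) :
    compositionOperator 𝕜 p f hf hf' φ =ᵐ[μ] φ ∘ f :=
  coeFn_compCLM 𝕜 p f f.measurable hf φ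

end Systems

end CompositionDynamics

/-!
Write `T = T_f` and let `c n` be the `L^p` norm of the indicator function of the level `f^{-n} W`.

Generalized hyperbolicity implies shadowing for every invertible operator on a Banach space. With
`P` and `Q` the projections of the splitting, the equation `y (n + 1) = T (y n) + z n` has the
solution `y n = ∑ T^k P z (n - 1 - k) - ∑ T^{-(k + 1)} Q z (n + k)`, which is bounded by a multiple
of `sup ‖z n‖` (`exists_bounded_solution`). Applied to the errors `z n = x (n + 1) - T (x n)` of a
pseudotrajectory `x`, it gives a true trajectory `x - y` close to `x`.

For the converse a single pseudotrajectory suffices. Choose `s` with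
`s (n + 1) - s n = 1 / c (n + 1)`; since `T^n 1_W` is the indicator function of `f^{-n} W`, the
sequence `δ s_n T^n 1_W` has jumps of norm exactly `δ`. If it is shadowed by the orbit of `y`, then
bounded distortion, which bounds `c n` times the average of `φ` over `W` by a multiple of `‖T^n φ‖`
(`exists_norm_setIntegral_mul_le`), shows that subtracting a constant from `s` gives a function `u`
with `|u n| ≤ C / c n` (`exists_primitive_of_hasShadowingProperty`). As `u` is increasing with
increments `1 / c`, this forces `c` to decay geometrically to the right wherever `u ≥ 0`, and to the
left wherever `u < 0` (`exists_geometric_bound_of_primitive`).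

Let `A` be the union of the levels `f^{-n} W` with `u n ≥ 0`. Then `f⁻¹ A ⊆ A`, and by bounded
distortion the decay of `c` becomes geometric decay of `μ (f^{-k} B) / μ B` for `B ⊆ A` and of
`μ (f^k B) / μ B` for `B ⊆ Aᶜ` (`measure_preimage_le_of_subset_iUnion`). Therefore the functions
supported on `A` and those supported on `Aᶜ` form the required splitting
(`isGeneralizedHyperbolic_of_geometric_measure_bound`). The cases in which `u` has constant sign
are those in which `T` or its inverse is a proper contraction.
-/

namespace CompositionDynamics

/-! ### Generalized hyperbolic operators have the shadowing property -/

section LinearDynamics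

variable {𝕜 : Type*} [NontriviallyNormedField 𝕜]
  {E : Type*} [NormedAddCommGroup E] [NormedSpace 𝕜 E]

theorem isProperContraction_of_norm_pow_le {S : E →L[𝕜] E} {C t : ℝ} (ht0 : 0 < t) (ht : t < 1)
    (h : ∀ n : ℕ, ‖S ^ n‖ ≤ C * t ^ n) : IsProperContraction S := by
  obtain ⟨r, htr, hr1⟩ := exists_between ht
  have hr0 : 0 < r := ht0.trans htr
  -- Any rate `r` strictly between `t` and `1` absorbs the constant `C`.
  have hlim : Tendsto (fun n : ℕ => C * (t / r) ^ n) atTop (nhds (C * 0)) :=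
    (tendsto_pow_atTop_nhds_zero_of_lt_one (by positivity) ((div_lt_one hr0).2 htr)).const_mul C
  rw [mul_zero] at hlim
  have hev : ∀ᶠ n : ℕ in atTop, (‖S ^ n‖₊ : ℝ≥0∞) ^ (1 / n : ℝ) ≤ ENNReal.ofReal r := by
    filter_upwards [hlim.eventually_lt_const one_pos, eventually_gt_atTop 0] with n hn hn0
    have h1 : ‖S ^ n‖ ≤ r ^ n := by
      refine (h n).trans ?_
      have : C * t ^ n = C * (t / r) ^ n * r ^ n := by
        rw [div_pow]; field_simp
      rw [this]
      exact mul_le_of_le_one_left (by positivity) hn.le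
    have h2 : (‖S ^ n‖₊ : ℝ≥0∞) ≤ ENNReal.ofReal r ^ n := by
      rw [← ENNReal.ofReal_pow hr0.le]
      exact (ofReal_norm (S ^ n)).symm.le.trans (ENNReal.ofReal_le_ofReal h1)
    calc (‖S ^ n‖₊ : ℝ≥0∞) ^ (1 / n : ℝ) ≤ (ENNReal.ofReal r ^ n) ^ (1 / n : ℝ) := by gcongr
      _ = ENNReal.ofReal r := by
        rw [one_div]
        exact ENNReal.pow_rpow_inv_natCast hn0.ne' _
  refine (limsup_le_of_le (by isBoundedDefault) hev).trans_lt ?_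
  simpa using hr1

theorem IsProperContraction.summable_norm_pow {S : E →L[𝕜] E} (h : IsProperContraction S) :
    Summable fun n : ℕ => ‖S ^ n‖ := by
  obtain ⟨r, hr, hr1⟩ := exists_between h
  lift r to ℝ≥0 using hr1.ne_top
  have hr1' : r < 1 := by exact_mod_cast hr1
  refine Summable.of_norm_bounded_eventually_nat
    (summable_geometric_of_lt_one r.coe_nonneg (by exact_mod_cast hr1')) ?_
  filter_upwards [eventually_lt_of_limsup_lt hr, eventually_gt_atTop 0] with n hn hn0
  rw [norm_norm]
  have h2 : (‖S ^ n‖₊ : ℝ≥0∞) ≤ (r : ℝ≥0∞) ^ n := by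
    calc (‖S ^ n‖₊ : ℝ≥0∞) = ((‖S ^ n‖₊ : ℝ≥0∞) ^ (1 / n : ℝ)) ^ n := by
          rw [one_div]; exact (ENNReal.rpow_inv_natCast_pow hn0.ne' _).symm
      _ ≤ (r : ℝ≥0∞) ^ n := by gcongr
  exact_mod_cast h2

theorem zpow_apply_of_trajectory (T : E ≃L[𝕜] E) {w : ℤ → E} (hw : ∀ n, w (n + 1) = T (w n))
    (n : ℤ) : (T ^ n) (w 0) = w n := by
  induction n using Int.induction_on with
  | zero => rfl
  | succ n ih =>
    rw [add_comm, zpow_add, zpow_one, add_comm (1 : ℤ), hw, ← ih]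
    rfl
  | pred n ih =>
    have h := hw (-(n : ℤ) - 1)
    rw [sub_add_cancel, ← ih] at h
    have h' : T ((T ^ (-(n : ℤ) - 1)) (w 0)) = (T ^ (-(n : ℤ))) (w 0) := by
      conv_rhs => rw [show -(n : ℤ) = 1 + (-(n : ℤ) - 1) by ring, zpow_add, zpow_one]
      rfl
    exact T.injective (h'.trans h)

/-- If the forward iterates of `T` are summable in norm on the range of `P`, and the backward
iterates on the range of `1 - P`, then the inhomogeneous equation `y (n + 1) = T (y n) + z n` has
a solution bounded by a multiple of `sup ‖z n‖`: it is the convolution of `z` with the Green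
function of `T`. -/
theorem exists_bounded_solution [CompleteSpace E] (T : E ≃L[𝕜] E) {P Q : E →L[𝕜] E}
    (hPQ : ∀ x, P x + Q x = x)
    (hP : Summable fun k : ℕ => ‖((T : E →L[𝕜] E) ^ k) ∘L P‖)
    (hQ : Summable fun k : ℕ => ‖((T.symm : E →L[𝕜] E) ^ k) ∘L Q‖) :
    ∃ C : ℝ, 0 < C ∧ ∀ (δ : ℝ) (z : ℤ → E), 0 ≤ δ → (∀ n, ‖z n‖ ≤ δ) →
      ∃ y : ℤ → E, (∀ n, y (n + 1) = T (y n) + z n) ∧ ∀ n, ‖y n‖ ≤ C * δ := by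
  set A : ℕ → E →L[𝕜] E := fun k => ((T : E →L[𝕜] E) ^ k) ∘L P with hA
  set B : ℕ → E →L[𝕜] E := fun k => ((T.symm : E →L[𝕜] E) ^ k) ∘L Q with hB
  have hTA : ∀ k x, T (A k x) = A (k + 1) x := fun k x => by
    simp only [hA, pow_succ', ContinuousLinearMap.comp_apply, mul_apply_eq_comp,
      ContinuousLinearEquiv.coe_coe]
  have hTB : ∀ k x, T (B (k + 1) x) = B k x := fun k x => by
    simp only [hB, pow_succ', ContinuousLinearMap.comp_apply, mul_apply_eq_comp,
      ContinuousLinearEquiv.coe_coe, ContinuousLinearEquiv.apply_symm_apply]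
  have hAB : ∀ x, A 0 x + B 0 x = x := fun x => by simpa [hA, hB] using hPQ x
  have hQ1 : Summable fun k : ℕ => ‖B (k + 1)‖ := 
    hQ.comp_injective (add_left_injective 1)
  have hSA : 0 ≤ ∑' k, ‖A k‖ := tsum_nonneg fun _ => norm_nonneg _
  have hSB : 0 ≤ ∑' k, ‖B (k + 1)‖ := tsum_nonneg fun _ => norm_nonneg _
  refine ⟨(∑' k, ‖A k‖) + (∑' k, ‖B (k + 1)‖) + 1, by positivity, fun δ z hδ hz => ?_⟩
  have bound : ∀ (D : ℕ → E →L[𝕜] E) (j : ℕ → ℤ) (k : ℕ), ‖D k (z (j k))‖ ≤ ‖D k‖ * δ :=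
    fun D j k => (D k).le_opNorm_of_le (hz _)
  have sumA : ∀ j : ℕ → ℤ, Summable fun k => A k (z (j k)) := fun j =>
    Summable.of_norm_bounded (hP.mul_right δ) (bound A j)
  have sumB : ∀ j : ℕ → ℤ, Summable fun k => B k (z (j k)) := fun j =>
    Summable.of_norm_bounded (hQ.mul_right δ) (bound B j)
  refine ⟨fun n => (∑' k : ℕ, A k (z (n - 1 - k))) - ∑' k : ℕ, B (k + 1) (z (n + k)),
    fun n => ?_, fun n => ?_⟩
  · rw [map_sub, T.map_tsum, T.map_tsum]
    simp only [hTA, hTB]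
    rw [(sumA fun k => n + 1 - 1 - k).tsum_eq_zero_add, (sumB fun k => n + k).tsum_eq_zero_add]
    have e1 : ∀ k : ℕ, n + 1 - 1 - ((k + 1 : ℕ) : ℤ) = n - 1 - k := fun k => by push_cast; ring
    have e2 : ∀ k : ℕ, n + ((k + 1 : ℕ) : ℤ) = n + 1 + k := fun k => by push_cast; ring
    simp only [e1, e2]
    have e3 : A 0 (z (n + 1 - 1 - ((0 : ℕ) : ℤ))) = z n - B 0 (z (n + ((0 : ℕ) : ℤ))) := by
      simpa using eq_sub_of_add_eq (hAB (z n))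
    rw [e3]
    abel
  · have h1 := tsum_of_norm_bounded (hP.mul_right δ).hasSum (bound A fun k => n - 1 - k)
    have h2 := tsum_of_norm_bounded (hQ1.mul_right δ).hasSum
      (bound (fun k => B (k + 1)) fun k => n + k)
    rw [tsum_mul_right] at h1 h2
    refine (norm_sub_le _ _).trans ?_
    nlinarith

theorem restrict_pow_apply (S : E →L[𝕜] E) {M : Submodule 𝕜 E} (hM : ∀ x ∈ M, S x ∈ M)
    (k : ℕ) (x : M) : ((S.restrict hM ^ k) x : E) = (S ^ k) x := by
  induction k with
  | zero => simp
  | succ k ih =>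
    rw [pow_succ', pow_succ', mul_apply_eq_comp, mul_apply_eq_comp,
      ContinuousLinearMap.coe_restrict_apply, ih]

theorem summable_norm_pow_comp_projection {S : E →L[𝕜] E} {M N : Submodule 𝕜 E}
    (hMN : M.IsTopCompl N) (hM : ∀ x ∈ M, S x ∈ M) (h : IsProperContraction (S.restrict hM)) :
    Summable fun k : ℕ => ‖(S ^ k) ∘L M.projectionL N hMN‖ := by
  refine Summable.of_nonneg_of_le (fun _ => norm_nonneg _) (fun k => ?_)
    (h.summable_norm_pow.mul_right ‖M.projectionOntoL N hMN‖)
  refine ContinuousLinearMap.opNorm_le_bound _ (by positivity) fun x => ?_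
  rw [ContinuousLinearMap.comp_apply, Submodule.projectionL_apply, ← restrict_pow_apply S hM,
    mul_assoc]
  exact (S.restrict hM ^ k).le_opNorm_of_le ((M.projectionOntoL N hMN).le_opNorm x)

theorem IsGeneralizedHyperbolic.hasShadowingProperty [CompleteSpace E] {T : E ≃L[𝕜] E}
    (h : IsGeneralizedHyperbolic T) : HasShadowingProperty T := by
  obtain ⟨M, N, hMc, hNc, hMN, hM, hN, hTM, hTN⟩ := h
  have htop : M.IsTopCompl N := Submodule.IsCompl.isTopCompl_of_isClosed hMN hMc hNc
  obtain ⟨C, hC, hsol⟩ := exists_bounded_solution T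
    (Submodule.projectionL_add_projectionL_eq_self htop)
    (summable_norm_pow_comp_projection htop hM hTM)
    (summable_norm_pow_comp_projection htop.symm hN hTN)
  intro ε hε
  refine ⟨ε / (2 * C), by positivity, fun x hx => ?_⟩
  obtain ⟨y, hy, hyb⟩ := hsol (ε / (2 * C)) (fun n => x (n + 1) - T (x n)) (by positivity)
    fun n => by rw [norm_sub_rev]; exact hx n
  refine ⟨x 0 - y 0, fun n => ?_⟩
  rw [zpow_apply_of_trajectory T (w := fun n => x n - y n)
    (fun n => by simp only [hy, map_sub]; abel) n, sub_sub_cancel_left, norm_neg]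
  refine (hyb n).trans_lt ?_
  rw [show C * (ε / (2 * C)) = ε / 2 by field_simp]
  exact half_lt_self hε

end LinearDynamics

/-! ### Scalar sequences with `u (n + 1) - u n = 1 / c (n + 1)` -/

theorem exists_forward_difference_eq {G : Type*} [AddCommGroup G] (ζ : ℤ → G) :
    ∃ s : ℤ → G, ∀ n, s (n + 1) - s n = ζ n := by
  refine ⟨fun n => ∑ i ∈ Finset.range n.toNat, ζ i
    - ∑ i ∈ Finset.range (-n).toNat, ζ (-(i : ℤ) - 1), fun n => ?_⟩
  obtain ⟨m, rfl | rfl⟩ := n.eq_nat_or_neg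
  · have h1 : ((m : ℤ) + 1).toNat = m + 1 := by omega
    have h2 : (-((m : ℤ) + 1)).toNat = 0 := by omega
    have h3 : (-(m : ℤ)).toNat = 0 := by omega
    beta_reduce
    rw [h1, h2, h3, Int.toNat_natCast, Finset.sum_range_succ]
    simp
  · cases m with
    | zero => simp
    | succ m =>
      have h1 : (-((m + 1 : ℕ) : ℤ) + 1).toNat = 0 := by omega
      have h2 : (-(-((m + 1 : ℕ) : ℤ) + 1)).toNat = m := by omega
      have h3 : (-((m + 1 : ℕ) : ℤ)).toNat = 0 := by omega
      have h4 : (- -((m + 1 : ℕ) : ℤ)).toNat = m + 1 := by omega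
      have h5 : -(m : ℤ) - 1 = -((m + 1 : ℕ) : ℤ) := by push_cast; ring
      beta_reduce
      rw [h1, h2, h3, h4, Finset.sum_range_succ, h5]
      simp

theorem le_pow_mul_of_le_mul {v : ℕ → ℝ} {t : ℝ} (ht : 0 ≤ t)
    (h : ∀ i, v i ≤ t * v (i + 1)) (k : ℕ) : v 0 ≤ t ^ k * v k := by
  induction k with
  | zero => simp
  | succ k ih =>
    calc v 0 ≤ t ^ k * v k := ih
      _ ≤ t ^ k * (t * v (k + 1)) := by gcongr; exact h k
      _ = t ^ (k + 1) * v (k + 1) := by ring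

/-- A primitive `u` of `1 / c` with `|u| ≤ C / c` forces an exponential dichotomy: where `u` is
nonnegative, `u` grows geometrically to the right, and there `c` decays geometrically to the
right; where `u` is negative, the same holds to the left. -/
theorem exists_geometric_bound_of_primitive {c u : ℤ → ℝ} {C D : ℝ} (hc : ∀ n, 0 < c n)
    (hu : ∀ n, u (n + 1) - u n = (c (n + 1))⁻¹) (hb : ∀ n, |u n| * c n ≤ C)
    (hD : ∀ n, c (n + 1) ≤ D * c n) :
    ∃ C' t : ℝ, 0 < C' ∧ 0 < t ∧ t < 1 ∧
      (∀ n, 0 ≤ u n → ∀ k : ℕ, c (n + k) ≤ C' * t ^ k * c n) ∧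
      (∀ n, u n < 0 → ∀ k : ℕ, c (n - k) ≤ C' * t ^ k * c n) := by
  wlog hC : 1 ≤ C generalizing C
  · exact this (C := max C 1) (fun n => (hb n).trans (le_max_left _ _)) (le_max_right _ _)
  have hC0 : 0 < C := by positivity
  have hD0 : 0 < D := by
    by_contra! hneg
    nlinarith [hc 0, hc (0 + 1), hD 0]
  have hinv : ∀ n, |u n| ≤ C * (c n)⁻¹ := fun n => by
    rw [← div_eq_mul_inv, le_div_iff₀ (hc n)]; exact hb n
  have hpos : ∀ n, 0 < (c n)⁻¹ := fun n => inv_pos.2 (hc n)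
  set t : ℝ := C / (C + 1) with ht
  have ht0 : 0 < t := by positivity
  have ht1 : t < 1 := by rw [ht, div_lt_one (by positivity)]; linarith
  -- Passing from `1 / c m ≤ t ^ k * (C / c j)` to the bound on `c j`.
  have hflip : ∀ (m j : ℤ) (k : ℕ), (c m)⁻¹ ≤ t ^ k * (C * (c j)⁻¹) → c j ≤ C * t ^ k * c m := by
    intro m j k h
    have h1 := mul_le_mul_of_nonneg_left h (mul_pos (hc m) (hc j)).le
    have hm := (hc m).ne'
    have hj := (hc j).ne'
    have e1 : c m * c j * (c m)⁻¹ = c j := by field_simp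
    have e2 : c m * c j * (t ^ k * (C * (c j)⁻¹)) = C * t ^ k * c m := by field_simp
    rwa [e1, e2] at h1
  have hup : ∀ n, 0 ≤ u n → ∀ i : ℕ, 0 ≤ u (n + i) := by
    intro n hn i
    induction i with
    | zero => simpa using hn
    | succ i ih =>
      have := hu (n + i)
      have := hpos (n + i + 1)
      push_cast
      rw [← add_assoc]
      linarith
  have hdown : ∀ n, u n < 0 → ∀ i : ℕ, u (n - i) < 0 := by
    intro n hn i
    induction i with
    | zero => simpa using hn
    | succ i ih =>
      have h1 := hu (n - i - 1)
      rw [sub_add_cancel] at h1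
      have := hpos (n - i)
      push_cast
      rw [← sub_sub]
      linarith
  -- `1 / c (n + 1)` is both the increment of `u` and at least `|u (n + 1)| / C`, so each step
  -- changes `|u|` by a definite proportion.
  have hfwd : ∀ n, 0 ≤ u n → u n ≤ t * u (n + 1) := by
    intro n hn
    have h1 := hu n
    have h2 := (le_abs_self _).trans (hinv (n + 1))
    have h3 : u n = u (n + 1) - (c (n + 1))⁻¹ := by linarith
    rw [ht, div_mul_eq_mul_div, le_div_iff₀ (by positivity), h3]
    linarith [hpos (n + 1)]
  have hbwd : ∀ n, u n < 0 → -u n ≤ t * -u (n - 1) := by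
    intro n hn
    have h1 := hu (n - 1)
    rw [sub_add_cancel] at h1
    have h2 := (neg_le_abs _).trans (hinv n)
    have h3 : u (n - 1) = u n - (c n)⁻¹ := by linarith
    rw [ht, div_mul_eq_mul_div, le_div_iff₀ (by positivity), h3]
    linarith
  -- At the first `n` with `u n ≥ 0` the bound `1 / c n ≤ u n` may fail, but `1 / c (n + 1)` is at
  -- most `u (n + 1)`; hence the shift by one, undone at the end by `hD`.
  have key1 : ∀ n, 0 ≤ u n → ∀ k : ℕ, c (n + 1 + k) ≤ C * t ^ k * c (n + 1) := by
    intro n hn k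
    refine hflip _ _ k ?_
    have h1 := le_pow_mul_of_le_mul (v := fun i : ℕ => u (n + 1 + i)) ht0.le (fun i => by
      have := hfwd (n + 1 + i) (by simpa [add_assoc] using hup n hn (1 + i))
      simpa [add_assoc] using this) k
    have h2 := (le_abs_self _).trans (hinv (n + 1 + k))
    have h3 : (c (n + 1))⁻¹ ≤ u (n + 1) := by linarith [hu n]
    have h4 : u (n + 1) ≤ t ^ k * u (n + 1 + k) := by simpa using h1
    exact (h3.trans h4).trans (by gcongr)
  have key2 : ∀ n, u n < 0 → ∀ k : ℕ, c (n - 1 - k) ≤ C * t ^ k * c n := by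
    intro n hn k
    refine hflip _ _ k ?_
    have h1 := le_pow_mul_of_le_mul (v := fun i : ℕ => -u (n - 1 - i)) ht0.le (fun i => by
      have := hbwd (n - 1 - i) (by simpa [sub_sub] using hdown n hn (1 + i))
      simpa [sub_sub, add_assoc] using this) k
    have h2 := (neg_le_abs _).trans (hinv (n - 1 - k))
    have h3 : (c n)⁻¹ ≤ -u (n - 1) := by
      have := hu (n - 1)
      rw [sub_add_cancel] at this
      linarith
    have h4 : -u (n - 1) ≤ t ^ k * -u (n - 1 - k) := by simpa using h1
    exact (h3.trans h4).trans (by gcongr)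
  refine ⟨1 + C * (D + 1) / t, t, by positivity, ht0, ht1, fun n hn k => ?_, fun n hn k => ?_⟩
  all_goals have hcn := hc n
  · cases k with
    | zero =>
      have : 0 ≤ C * (D + 1) / t * c n := by positivity
      simp only [Nat.cast_zero, add_zero, pow_zero, mul_one]
      linarith
    | succ k =>
      have h1 := key1 n hn k
      have h2 : C * t ^ k * c (n + 1) ≤ C * t ^ k * (D * c n) := by gcongr; exact hD n
      have h3 : (1 + C * (D + 1) / t) * t ^ (k + 1) * c n
          = C * t ^ k * (D * c n) + (t ^ (k + 1) * c n + C * t ^ k * c n) := by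
        field_simp; ring
      have h4 : 0 ≤ t ^ (k + 1) * c n + C * t ^ k * c n := by positivity
      have h5 : n + ((k + 1 : ℕ) : ℤ) = n + 1 + k := by push_cast; ring
      rw [h5]
      linarith
  · cases k with
    | zero =>
      have : 0 ≤ C * (D + 1) / t * c n := by positivity
      simp only [Nat.cast_zero, sub_zero, pow_zero, mul_one]
      linarith
    | succ k =>
      have h1 := key2 n hn k
      have h3 : (1 + C * (D + 1) / t) * t ^ (k + 1) * c n
          = C * t ^ k * c n + (t ^ (k + 1) * c n + C * t ^ k * (D * c n)) := by
        field_simp; ring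
      have h4 : 0 ≤ t ^ (k + 1) * c n + C * t ^ k * (D * c n) := by positivity
      have h5 : n - ((k + 1 : ℕ) : ℤ) = n - 1 - k := by push_cast; ring
      rw [h5]
      linarith

section Systems

variable {X : Type*} [MeasurableSpace X] {μ : Measure X}

/-! ### Integer iterates of the underlying map -/

/-- The integer iterate `f^k` as a map `X → X`. -/
def iterMap (f : X ≃ᵐ X) (k : ℤ) : X → X :=
  ⇑((f.toEquiv : Equiv.Perm X) ^ k)

theorem iterMap_zero (f : X ≃ᵐ X) : iterMap f 0 = id := by
  rw [iterMap, zpow_zero]; rfl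

theorem iterMap_one (f : X ≃ᵐ X) : iterMap f 1 = f := by
  rw [iterMap, zpow_one]; rfl

theorem iterMap_neg_one (f : X ≃ᵐ X) : iterMap f (-1) = f.symm := by
  rw [iterMap, zpow_neg_one]; rfl

theorem iterMap_add (f : X ≃ᵐ X) (k l : ℤ) : iterMap f (k + l) = iterMap f k ∘ iterMap f l := by
  rw [iterMap, zpow_add]; rfl

theorem preimage_iterMap_add (f : X ≃ᵐ X) (k l : ℤ) (B : Set X) :
    iterMap f l ⁻¹' (iterMap f k ⁻¹' B) = iterMap f (k + l) ⁻¹' B := by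
  rw [iterMap_add, preimage_comp]

theorem preimage_iterMap_neg_self (f : X ≃ᵐ X) (k : ℤ) (B : Set X) :
    iterMap f k ⁻¹' (iterMap f (-k) ⁻¹' B) = B := by
  rw [preimage_iterMap_add, neg_add_cancel, iterMap_zero, preimage_id]

theorem iterImage_eq_preimage (f : X ≃ᵐ X) (k : ℤ) (B : Set X) :
    iterImage f k B = iterMap f (-k) ⁻¹' B := by
  rw [iterImage, iterMap, zpow_neg]
  exact Equiv.image_eq_preimage_symm _ _

theorem measurable_iterMap (f : X ≃ᵐ X) (k : ℤ) : Measurable (iterMap f k) := by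
  induction k using Int.induction_on with
  | zero => rw [iterMap_zero]; exact measurable_id
  | succ n ih => rw [iterMap_add, iterMap_one]; exact ih.comp f.measurable
  | pred n ih =>
    rw [sub_eq_add_neg, iterMap_add, iterMap_neg_one]; exact ih.comp f.symm.measurable

theorem HasBoundedPreimages.comp {g h : X → X} (hg : HasBoundedPreimages g μ)
    (hh : HasBoundedPreimages h μ) (hgm : Measurable g) : HasBoundedPreimages (g ∘ h) μ := by
  obtain ⟨c, hc0, hc⟩ := hg
  obtain ⟨d, hd0, hd⟩ := hh
  refine ⟨d * c, by positivity, fun B hB => ?_⟩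
  rw [preimage_comp, ENNReal.coe_mul, mul_assoc]
  exact (hd _ (hgm hB)).trans (by gcongr; exact hc B hB)

theorem hasBoundedPreimages_iterMap {f : X ≃ᵐ X} (hf : HasBoundedPreimages f μ)
    (hf' : HasBoundedPreimages f.symm μ) (k : ℤ) : HasBoundedPreimages (iterMap f k) μ := by
  induction k using Int.induction_on with
  | zero => exact ⟨1, one_pos, fun B _ => by simp [iterMap_zero]⟩
  | succ n ih => rw [iterMap_add, iterMap_one]; exact ih.comp hf (measurable_iterMap f _)
  | pred n ih =>
    rw [sub_eq_add_neg, iterMap_add, iterMap_neg_one]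
    exact ih.comp hf' (measurable_iterMap f _)

theorem quasiMeasurePreserving_iterMap {f : X ≃ᵐ X} (hf : HasBoundedPreimages f μ)
    (hf' : HasBoundedPreimages f.symm μ) (k : ℤ) :
    Measure.QuasiMeasurePreserving (iterMap f k) μ μ :=
  (hasBoundedPreimages_iterMap hf hf' k).quasiMeasurePreserving (measurable_iterMap f k)

/-! ### Measure estimates from bounded distortion -/

theorem HasBoundedDistortionOn.exists_preimage_bound {f : X ≃ᵐ X} {W : Set X}
    (h : HasBoundedDistortionOn μ f W) :
    ∃ K : ℝ≥0, ∀ (n : ℤ) (B : Set X), MeasurableSet B → B ⊆ W →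
      μ (iterMap f n ⁻¹' W) * μ B ≤ K * (μ (iterMap f n ⁻¹' B) * μ W) ∧
      μ (iterMap f n ⁻¹' B) * μ W ≤ K * (μ (iterMap f n ⁻¹' W) * μ B) := by
  obtain ⟨K, hK, h⟩ := h
  refine ⟨K, fun n B hB hBW => ?_⟩
  have h' := h (-n) B hB hBW
  simp only [iterImage_eq_preimage, neg_neg] at h'
  refine ⟨?_, h'.2⟩
  rw [← ENNReal.div_le_iff' (by exact_mod_cast hK.ne') ENNReal.coe_ne_top, div_eq_mul_inv, mul_comm]
  exact h'.1

/-- The levels `f^{-n} W` of a dissipative system are pairwise disjoint and cover `X`. -/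
theorem IsDissipativeGeneratedBy.preimage_partition {f : X ≃ᵐ X} {W : Set X}
    (h : IsDissipativeGeneratedBy μ f W) :
    Pairwise (fun j k : ℤ => Disjoint (iterMap f j ⁻¹' W) (iterMap f k ⁻¹' W)) ∧
      ⋃ k : ℤ, iterMap f k ⁻¹' W = univ := by
  obtain ⟨-, -, -, hd, hU⟩ := h
  simp only [iterImage_eq_preimage] at hd hU
  refine ⟨fun j k hjk => by simpa using hd (neg_injective.ne hjk), ?_⟩
  rw [← hU]
  exact ((Equiv.neg ℤ).surjective.iUnion_comp fun k => iterMap f k ⁻¹' W).symm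

/-- By bounded distortion, `f^{-k}` rescales the measure of every subset of the level `f^{-n} W`
in the same way, up to a constant, as it rescales the whole level. -/
theorem measure_preimage_le_of_subset_level {f : X ≃ᵐ X} {W : Set X} {K : ℝ≥0}
    (hW0 : μ W ≠ 0) (hW : μ W ≠ ∞)
    (hK : ∀ (n : ℤ) (B : Set X), MeasurableSet B → B ⊆ W →
      μ (iterMap f n ⁻¹' W) * μ B ≤ K * (μ (iterMap f n ⁻¹' B) * μ W) ∧
      μ (iterMap f n ⁻¹' B) * μ W ≤ K * (μ (iterMap f n ⁻¹' W) * μ B))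
    {n k : ℤ} {r : ℝ≥0∞} (hr : μ (iterMap f (n + k) ⁻¹' W) ≤ r * μ (iterMap f n ⁻¹' W))
    {B : Set X} (hB : MeasurableSet B) (hBn : B ⊆ iterMap f n ⁻¹' W) :
    μ (iterMap f k ⁻¹' B) ≤ K * K * r * μ B := by
  obtain ⟨B', hB', hB'W, rfl⟩ : ∃ B', MeasurableSet B' ∧ B' ⊆ W ∧ iterMap f n ⁻¹' B' = B := by
    refine ⟨iterMap f (-n) ⁻¹' B, measurable_iterMap f _ hB, ?_, preimage_iterMap_neg_self f n B⟩
    have := preimage_mono (f := iterMap f (-n)) hBn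
    rwa [preimage_iterMap_add, add_neg_cancel, iterMap_zero, preimage_id] at this
  rw [preimage_iterMap_add, ← ENNReal.mul_le_mul_iff_left hW0 hW]
  calc μ (iterMap f (n + k) ⁻¹' B') * μ W
      ≤ K * (μ (iterMap f (n + k) ⁻¹' W) * μ B') := (hK _ B' hB' hB'W).2
    _ ≤ K * (r * μ (iterMap f n ⁻¹' W) * μ B') := by gcongr
    _ = K * r * (μ (iterMap f n ⁻¹' W) * μ B') := by ring
    _ ≤ K * r * (K * (μ (iterMap f n ⁻¹' B') * μ W)) := by
        gcongr K * r * ?_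
        exact (hK _ B' hB' hB'W).1
    _ = K * K * r * μ (iterMap f n ⁻¹' B') * μ W := by ring

/-- The estimate for subsets of one level, summed over a union of levels. -/
theorem measure_preimage_le_of_subset_iUnion {f : X ≃ᵐ X} {W : Set X} {K : ℝ≥0}
    (hWm : MeasurableSet W) (hW0 : μ W ≠ 0) (hW : μ W ≠ ∞)
    (hpart : Pairwise (fun j k : ℤ => Disjoint (iterMap f j ⁻¹' W) (iterMap f k ⁻¹' W)) ∧
      ⋃ k : ℤ, iterMap f k ⁻¹' W = univ)
    (hK : ∀ (n : ℤ) (B : Set X), MeasurableSet B → B ⊆ W →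
      μ (iterMap f n ⁻¹' W) * μ B ≤ K * (μ (iterMap f n ⁻¹' B) * μ W) ∧
      μ (iterMap f n ⁻¹' B) * μ W ≤ K * (μ (iterMap f n ⁻¹' W) * μ B))
    {I : Set ℤ} {k : ℤ} {r : ℝ≥0∞}
    (hr : ∀ n ∈ I, μ (iterMap f (n + k) ⁻¹' W) ≤ r * μ (iterMap f n ⁻¹' W))
    {B : Set X} (hB : MeasurableSet B) (hBI : B ⊆ ⋃ n ∈ I, iterMap f n ⁻¹' W) :
    μ (iterMap f k ⁻¹' B) ≤ K * K * r * μ B := by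
  have hBn : ∀ n : ℤ, MeasurableSet (B ∩ iterMap f n ⁻¹' W) := fun n =>
    hB.inter (measurable_iterMap f n hWm)
  have hBU : B = ⋃ n : ℤ, B ∩ iterMap f n ⁻¹' W := by
    rw [← inter_iUnion, hpart.2, inter_univ]
  have hsum : μ B = ∑' n : ℤ, μ (B ∩ iterMap f n ⁻¹' W) := by
    conv_lhs => rw [hBU]
    exact measure_iUnion
      (fun i j hij => (hpart.1 hij).mono inter_subset_right inter_subset_right) hBn
  have hn : ∀ n : ℤ, μ (iterMap f k ⁻¹' (B ∩ iterMap f n ⁻¹' W))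
      ≤ K * K * r * μ (B ∩ iterMap f n ⁻¹' W) := by
    intro n
    by_cases hnI : n ∈ I
    · exact measure_preimage_le_of_subset_level hW0 hW hK (hr n hnI) (hBn n) inter_subset_right
    · have hempty : B ∩ iterMap f n ⁻¹' W = ∅ := by
        refine eq_empty_of_forall_notMem fun x hx => ?_
        obtain ⟨m, hm, hxm⟩ := mem_iUnion₂.1 (hBI hx.1)
        have hmn : m ≠ n := fun h => hnI (h ▸ hm)
        exact (disjoint_left.1 (hpart.1 hmn)) hxm hx.2
      simp [hempty]
  calc μ (iterMap f k ⁻¹' B) = μ (⋃ n : ℤ, iterMap f k ⁻¹' (B ∩ iterMap f n ⁻¹' W)) := by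
        rw [← preimage_iUnion, ← hBU]
    _ ≤ ∑' n : ℤ, μ (iterMap f k ⁻¹' (B ∩ iterMap f n ⁻¹' W)) := measure_iUnion_le _
    _ ≤ ∑' n : ℤ, K * K * r * μ (B ∩ iterMap f n ⁻¹' W) := ENNReal.tsum_le_tsum hn
    _ = K * K * r * μ B := by rw [ENNReal.tsum_mul_left, hsum]

/-! ### Powers of the composition operator -/

section Operator

variable (𝕜 : Type*) [RCLike 𝕜] (p : ℝ≥0∞) [Fact (1 ≤ p)]

theorem coeFn_zpow_compositionOperator (f : X ≃ᵐ X) (hf : HasBoundedPreimages f μ)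
    (hf' : HasBoundedPreimages f.symm μ) (k : ℤ) (φ : Lp 𝕜 p μ) :
    (compositionOperator 𝕜 p f hf hf' ^ k) φ =ᵐ[μ] φ ∘ iterMap f k := by
  set T := compositionOperator 𝕜 p f hf hf' with hT
  induction k using Int.induction_on with
  | zero => rw [iterMap_zero]; rfl
  | succ n ih =>
    have h1 : (T ^ ((n : ℤ) + 1)) φ = T ((T ^ (n : ℤ)) φ) := by
      rw [add_comm, zpow_add, zpow_one]; rfl
    rw [h1, iterMap_add, iterMap_one, ← Function.comp_assoc]
    exact (coeFn_compositionOperator 𝕜 p f hf hf' _).trans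
      ((hf.quasiMeasurePreserving f.measurable).ae_eq_comp ih)
  | pred n ih =>
    have h1 : (T ^ (-(n : ℤ) - 1)) φ = T.symm ((T ^ (-(n : ℤ))) φ) := by
      rw [sub_eq_neg_add, zpow_add, zpow_neg_one]; rfl
    rw [h1, sub_eq_add_neg, iterMap_add, iterMap_neg_one, ← Function.comp_assoc]
    exact (coeFn_compCLM 𝕜 p f.symm f.symm.measurable hf' _).trans
      ((hf'.quasiMeasurePreserving f.symm.measurable).ae_eq_comp ih)

theorem pow_apply_eq_zpow {E : Type*} [NormedAddCommGroup E] [NormedSpace 𝕜 E] (T : E ≃L[𝕜] E)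
    (k : ℕ) (x : E) : ((T : E →L[𝕜] E) ^ k) x = (T ^ (k : ℤ)) x := by
  induction k with
  | zero => rfl
  | succ k ih =>
    rw [pow_succ', mul_apply_eq_comp, ih, Nat.cast_succ, add_comm, zpow_add, zpow_one]; rfl

theorem symm_pow_apply_eq_zpow {E : Type*} [NormedAddCommGroup E] [NormedSpace 𝕜 E]
    (T : E ≃L[𝕜] E) (k : ℕ) (x : E) : ((T.symm : E →L[𝕜] E) ^ k) x = (T ^ (-(k : ℤ))) x := by
  rw [pow_apply_eq_zpow, show T.symm = T⁻¹ from rfl, inv_zpow']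

/-- If `φ` vanishes off `A` and `f^{-k}` expands the measure of subsets of `A` at most `q` times,
then `‖φ ∘ f^k‖ ≤ q ^ (1 / p) ‖φ‖`. -/
theorem norm_zpow_compositionOperator_le (f : X ≃ᵐ X) (hf : HasBoundedPreimages f μ)
    (hf' : HasBoundedPreimages f.symm μ) {A : Set X} (hA : MeasurableSet A) {k : ℤ} {q : ℝ≥0∞}
    (hq : q ≠ ∞) (h : ∀ B, MeasurableSet B → B ⊆ A → μ (iterMap f k ⁻¹' B) ≤ q * μ B)
    (φ : Lp 𝕜 p μ) (hφ : ∀ᵐ x ∂μ, x ∉ A → φ x = 0) :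
    ‖(compositionOperator 𝕜 p f hf hf' ^ k) φ‖ ≤ q.toReal ^ (1 / p).toReal * ‖φ‖ := by
  have hqmp := quasiMeasurePreserving_iterMap hf hf' k
  have hle : (μ.map (iterMap f k)).restrict A ≤ q • μ := by
    refine Measure.le_iff.2 fun B hB => ?_
    rw [Measure.restrict_apply hB, Measure.map_apply hqmp.measurable (hB.inter hA)]
    refine (h _ (hB.inter hA) inter_subset_right).trans ?_
    rw [Measure.smul_apply, smul_eq_mul]
    gcongr
    exact inter_subset_left
  have hind : (φ : X → 𝕜) =ᵐ[μ] A.indicator φ := by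
    filter_upwards [hφ] with x hx
    by_cases hxA : x ∈ A
    · rw [indicator_of_mem hxA]
    · rw [indicator_of_notMem hxA, hx hxA]
  rw [Lp.norm_def, Lp.norm_def, ENNReal.toReal_rpow, ← ENNReal.toReal_mul]
  refine ENNReal.toReal_mono (ENNReal.mul_ne_top
    (ENNReal.rpow_ne_top_of_nonneg ENNReal.toReal_nonneg hq) (Lp.eLpNorm_ne_top φ)) ?_
  rw [eLpNorm_congr_ae (coeFn_zpow_compositionOperator 𝕜 p f hf hf' k φ),
    eLpNorm_congr_ae (hqmp.ae_eq_comp hind),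
    ← eLpNorm_map_measure (((Lp.aestronglyMeasurable φ).indicator hA).mono_ac
      hqmp.absolutelyContinuous) hqmp.measurable.aemeasurable,
    eLpNorm_indicator_eq_eLpNorm_restrict hA]
  exact eLpNorm_le_of_measure_le_smul hle

/-- The functions in `L^p` that vanish almost everywhere off `A`, as the kernel of the restriction
to the complement of `A`. -/
noncomputable def lpSupportedOn (μ : Measure X) (A : Set X) : Submodule 𝕜 (Lp 𝕜 p μ) :=
  (LpToLpRestrictCLM X 𝕜 𝕜 μ p Aᶜ).ker

theorem mem_lpSupportedOn {A : Set X} (hA : MeasurableSet A) (φ : Lp 𝕜 p μ) :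
    φ ∈ lpSupportedOn 𝕜 p μ A ↔ ∀ᵐ x ∂μ, x ∉ A → φ x = 0 := by
  have h : φ ∈ lpSupportedOn 𝕜 p μ A ↔ LpToLpRestrictCLM X 𝕜 𝕜 μ p Aᶜ φ = 0 := Iff.rfl
  have h2 : (∀ᵐ x ∂μ, x ∉ A → φ x = 0) ↔ φ =ᵐ[μ.restrict Aᶜ] 0 :=
    (ae_restrict_iff' hA.compl).symm
  rw [h, h2, Lp.eq_zero_iff_ae_eq_zero]
  have h3 := LpToLpRestrictCLM_coeFn 𝕜 Aᶜ φ
  exact ⟨fun h => h3.symm.trans h, fun h => h3.trans h⟩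

theorem isClosed_lpSupportedOn (A : Set X) :
    IsClosed (lpSupportedOn 𝕜 p μ A : Set (Lp 𝕜 p μ)) :=
  (LpToLpRestrictCLM X 𝕜 𝕜 μ p Aᶜ).isClosed_ker

theorem isCompl_lpSupportedOn {A : Set X} (hA : MeasurableSet A) :
    IsCompl (lpSupportedOn 𝕜 p μ A) (lpSupportedOn 𝕜 p μ Aᶜ) := by
  constructor
  · refine Submodule.disjoint_def.2 fun φ h1 h2 => ?_
    rw [mem_lpSupportedOn 𝕜 p hA] at h1
    rw [mem_lpSupportedOn 𝕜 p hA.compl] at h2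
    rw [Lp.eq_zero_iff_ae_eq_zero]
    filter_upwards [h1, h2] with x hx1 hx2
    by_cases hxA : x ∈ A
    · exact hx2 (not_not.2 hxA)
    · exact hx1 hxA
  · refine Submodule.codisjoint_iff_exists_add_eq.2 fun φ => ?_
    have hmem : ∀ B : Set X, MeasurableSet B → MemLp (B.indicator φ) p μ := fun B hB =>
      (Lp.memLp φ).indicator hB
    refine ⟨(hmem A hA).toLp _, (hmem Aᶜ hA.compl).toLp _, ?_, ?_, ?_⟩
    · rw [mem_lpSupportedOn 𝕜 p hA]
      filter_upwards [(hmem A hA).coeFn_toLp] with x hx hxA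
      rw [hx, indicator_of_notMem hxA]
    · rw [mem_lpSupportedOn 𝕜 p hA.compl]
      filter_upwards [(hmem Aᶜ hA.compl).coeFn_toLp] with x hx hxA
      rw [hx, indicator_of_notMem hxA]
    · refine Lp.ext ?_
      filter_upwards [Lp.coeFn_add ((hmem A hA).toLp _) ((hmem Aᶜ hA.compl).toLp _),
        (hmem A hA).coeFn_toLp, (hmem Aᶜ hA.compl).coeFn_toLp] with x h1 h2 h3
      rw [h1, Pi.add_apply, h2, h3]
      exact congrFun (indicator_self_add_compl A φ) x

/-- A set `A` with `f⁻¹ A ⊆ A` on which `f^{-k}` shrinks measure geometrically, while `f^k` does so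
on its complement, yields the splitting of `L^p` into functions supported on `A` and on `Aᶜ`. -/
theorem isGeneralizedHyperbolic_of_geometric_measure_bound (f : X ≃ᵐ X)
    (hf : HasBoundedPreimages f μ) (hf' : HasBoundedPreimages f.symm μ)
    {A : Set X} (hA : MeasurableSet A) (hfA : f ⁻¹' A ⊆ A) {q : ℕ → ℝ≥0∞} {C t : ℝ}
    (ht0 : 0 < t) (ht1 : t < 1) (hq : ∀ k, q k ≠ ∞)
    (hqt : ∀ k, (q k).toReal ^ (1 / p).toReal ≤ C * t ^ k)
    (h1 : ∀ (k : ℕ) (B : Set X), MeasurableSet B → B ⊆ A →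
      μ (iterMap f k ⁻¹' B) ≤ q k * μ B)
    (h2 : ∀ (k : ℕ) (B : Set X), MeasurableSet B → B ⊆ Aᶜ →
      μ (iterMap f (-k) ⁻¹' B) ≤ q k * μ B) :
    IsGeneralizedHyperbolic (compositionOperator 𝕜 p f hf hf') := by
  set T := compositionOperator 𝕜 p f hf hf' with hT
  have hM : ∀ φ ∈ lpSupportedOn 𝕜 p μ A,
      (T : Lp 𝕜 p μ →L[𝕜] Lp 𝕜 p μ) φ ∈ lpSupportedOn 𝕜 p μ A := by
    intro φ hφ
    rw [mem_lpSupportedOn 𝕜 p hA] at hφ ⊢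
    filter_upwards [coeFn_compositionOperator 𝕜 p f hf hf' φ,
      (hf.quasiMeasurePreserving f.measurable).ae hφ] with x hx1 hx2 hxA
    exact hx1.trans (hx2 fun h => hxA (hfA h))
  have hN : ∀ φ ∈ lpSupportedOn 𝕜 p μ Aᶜ,
      (T.symm : Lp 𝕜 p μ →L[𝕜] Lp 𝕜 p μ) φ ∈ lpSupportedOn 𝕜 p μ Aᶜ := by
    intro φ hφ
    rw [mem_lpSupportedOn 𝕜 p hA.compl] at hφ ⊢
    filter_upwards [coeFn_compCLM 𝕜 p f.symm f.symm.measurable hf' φ,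
      (hf'.quasiMeasurePreserving f.symm.measurable).ae hφ] with x hx1 hx2 hxA
    refine hx1.trans (hx2 fun h => hxA fun hx => h (hfA ?_))
    rwa [mem_preimage, f.apply_symm_apply]
  have hC : 0 ≤ C := by
    have := (Real.rpow_nonneg ENNReal.toReal_nonneg _).trans (hqt 0)
    simpa using this
  refine ⟨_, _, isClosed_lpSupportedOn 𝕜 p A, isClosed_lpSupportedOn 𝕜 p Aᶜ,
    isCompl_lpSupportedOn 𝕜 p hA, hM, hN, ?_, ?_⟩
  · refine isProperContraction_of_norm_pow_le (C := C) ht0 ht1 fun k =>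
      ContinuousLinearMap.opNorm_le_bound _ (by positivity) fun φ => ?_
    rw [Submodule.coe_norm, restrict_pow_apply, pow_apply_eq_zpow]
    refine (norm_zpow_compositionOperator_le 𝕜 p f hf hf' hA (hq k) (h1 k) φ
      ((mem_lpSupportedOn 𝕜 p hA _).1 φ.2)).trans ?_
    gcongr
    exacts [hqt k, le_rfl]
  · refine isProperContraction_of_norm_pow_le (C := C) ht0 ht1 fun k =>
      ContinuousLinearMap.opNorm_le_bound _ (by positivity) fun φ => ?_
    rw [Submodule.coe_norm, restrict_pow_apply, symm_pow_apply_eq_zpow]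
    refine (norm_zpow_compositionOperator_le 𝕜 p f hf hf' hA.compl (hq k) (h2 k) φ
      ((mem_lpSupportedOn 𝕜 p hA.compl _).1 φ.2)).trans ?_
    gcongr
    exacts [hqt k, le_rfl]

end Operator

/-! ### The test pseudotrajectory and its shadow -/

section Shadowing

variable (𝕜 : Type*) [RCLike 𝕜] (p : ℝ≥0∞) [Fact (1 ≤ p)]

/-- The integral over `W` is controlled by the norm of `T^n φ`, with a constant that is inversely
proportional to the norm of the indicator function of the level `f^{-n} W`. -/
theorem exists_norm_setIntegral_mul_le {f : X ≃ᵐ X} (hf : HasBoundedPreimages f μ)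
    (hf' : HasBoundedPreimages f.symm μ) {W : Set X} {K : ℝ≥0} (hWm : MeasurableSet W)
    (hW : μ W ≠ ∞) (hV0 : ∀ n, μ (iterMap f n ⁻¹' W) ≠ 0) (hV : ∀ n, μ (iterMap f n ⁻¹' W) ≠ ∞)
    (hK : ∀ (n : ℤ) (B : Set X), MeasurableSet B → B ⊆ W →
      μ (iterMap f n ⁻¹' W) * μ B ≤ K * (μ (iterMap f n ⁻¹' B) * μ W)) :
    ∃ C : ℝ, ∀ (n : ℤ) (φ : Lp 𝕜 p μ),
      ‖∫ x in W, φ x ∂μ‖ * μ.real (iterMap f n ⁻¹' W) ^ (1 / p).toReal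
        ≤ C * ‖(compositionOperator 𝕜 p f hf hf' ^ n) φ‖ := by
  set T := compositionOperator 𝕜 p f hf hf' with hT
  set e : ℝ := 1 / (1 : ℝ≥0∞).toReal - 1 / p.toReal with he
  have hp1 : 1 ≤ p := Fact.out
  have he0 : 0 ≤ e := by
    rw [he]
    by_cases hp : p = ∞
    · simp [hp]
    · have : 1 ≤ p.toReal := by
        rw [← ENNReal.toReal_one]; exact ENNReal.toReal_mono hp hp1
      have := inv_le_one_of_one_le₀ this
      simpa using this
  refine ⟨(K * μ W).toReal ^ (1 / p).toReal * (μ W).toReal ^ e, fun n φ => ?_⟩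
  have hqmp := quasiMeasurePreserving_iterMap hf hf' (-n)
  set V := iterMap f n ⁻¹' W with hVdef
  -- Transporting `μ` on `W` to the level `f^{-n} W` multiplies it by about `μ W / μ (f^{-n} W)`.
  have hle : (μ.restrict W).map (iterMap f (-n)) ≤ (K * μ W / μ V) • μ := by
    refine Measure.le_iff.2 fun B hB => ?_
    have hB' := hqmp.measurable hB
    rw [Measure.map_apply hqmp.measurable hB, Measure.restrict_apply hB', Measure.smul_apply,
      smul_eq_mul, ENNReal.mul_comm_div, ← mul_div_assoc,
      ENNReal.le_div_iff_mul_le (Or.inl (hV0 n)) (Or.inl (hV n)), mul_comm]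
    refine (hK n _ (hB'.inter hWm) inter_subset_right).trans ?_
    have : iterMap f n ⁻¹' (iterMap f (-n) ⁻¹' B ∩ W) ⊆ B := by
      rw [preimage_inter, preimage_iterMap_neg_self]
      exact inter_subset_left
    calc K * (μ (iterMap f n ⁻¹' (iterMap f (-n) ⁻¹' B ∩ W)) * μ W)
        ≤ K * (μ B * μ W) := by gcongr
      _ = K * μ W * μ B := by ring
  have hφ : (φ : X → 𝕜) =ᵐ[μ] (T ^ n) φ ∘ iterMap f (-n) := by
    have := coeFn_zpow_compositionOperator 𝕜 p f hf hf' (-n) ((T ^ n) φ)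
    have h2 : (T ^ (-n)) ((T ^ n) φ) = φ := by
      have : (T ^ (-n) * T ^ n) φ = φ := by rw [← zpow_add, neg_add_cancel, zpow_zero]; rfl
      exact this
    rwa [← hT, h2] at this
  have hmain : ‖∫ x in W, φ x ∂μ‖ₑ
      ≤ (K * μ W / μ V) ^ (1 / p).toReal * eLpNorm ((T ^ n) φ) p μ * μ W ^ e := by
    calc ‖∫ x in W, φ x ∂μ‖ₑ ≤ eLpNorm φ 1 (μ.restrict W) := by
          rw [eLpNorm_one_eq_lintegral_enorm]
          exact enorm_integral_le_lintegral_enorm _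
      _ ≤ eLpNorm φ p (μ.restrict W) * μ.restrict W univ ^ e :=
          eLpNorm_le_eLpNorm_mul_rpow_measure_univ hp1 (Lp.aestronglyMeasurable φ).restrict
      _ ≤ _ := by
          rw [Measure.restrict_apply_univ]
          gcongr
          rw [eLpNorm_congr_ae (ae_restrict_of_ae hφ), ← eLpNorm_map_measure
            ((Lp.aestronglyMeasurable _).mono_ac (Measure.absolutelyContinuous_of_le_smul hle))
            hqmp.measurable.aemeasurable]
          exact eLpNorm_le_of_measure_le_smul hle
  have hVpos : 0 < μ.real V ^ (1 / p).toReal :=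
    Real.rpow_pos_of_pos (ENNReal.toReal_pos (hV0 n) (hV n)) _
  have hfin : K * μ W / μ V ≠ ∞ :=
    ENNReal.div_ne_top (ENNReal.mul_ne_top ENNReal.coe_ne_top hW) (hV0 n)
  have hreal := ENNReal.toReal_mono (ENNReal.mul_ne_top (ENNReal.mul_ne_top
    (ENNReal.rpow_ne_top_of_nonneg ENNReal.toReal_nonneg hfin) (Lp.eLpNorm_ne_top ((T ^ n) φ)))
    (ENNReal.rpow_ne_top_of_nonneg he0 hW)) hmain
  rw [toReal_enorm, ENNReal.toReal_mul, ENNReal.toReal_mul, ← ENNReal.toReal_rpow,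
    ← ENNReal.toReal_rpow, ← Lp.norm_def, ENNReal.toReal_div,
    Real.div_rpow ENNReal.toReal_nonneg ENNReal.toReal_nonneg] at hreal
  rw [← le_div_iff₀ hVpos]
  refine hreal.trans_eq ?_
  rw [measureReal_def]
  ring

theorem norm_zpow_indicatorConstLp (hp : p ≠ ∞) {f : X ≃ᵐ X} (hf : HasBoundedPreimages f μ)
    (hf' : HasBoundedPreimages f.symm μ) {W : Set X} (hWm : MeasurableSet W) (hW : μ W ≠ ∞)
    (n : ℤ) :
    ‖(compositionOperator 𝕜 p f hf hf' ^ n) (indicatorConstLp p hWm hW (1 : 𝕜))‖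
      = μ.real (iterMap f n ⁻¹' W) ^ (1 / p).toReal := by
  have hVm := measurable_iterMap f n hWm
  have hV : μ (iterMap f n ⁻¹' W) ≠ ∞ := by
    obtain ⟨c, -, hc⟩ := hasBoundedPreimages_iterMap hf hf' n
    exact ne_top_of_le_ne_top (ENNReal.mul_ne_top ENNReal.coe_ne_top hW) (hc W hWm)
  have h : (compositionOperator 𝕜 p f hf hf' ^ n) (indicatorConstLp p hWm hW (1 : 𝕜))
      = indicatorConstLp p hVm hV (1 : 𝕜) := by
    refine Lp.ext ?_
    refine (coeFn_zpow_compositionOperator 𝕜 p f hf hf' n _).trans ?_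
    refine ((quasiMeasurePreserving_iterMap hf hf' n).ae_eq_comp indicatorConstLp_coeFn).trans ?_
    exact indicatorConstLp_coeFn.symm
  rw [h, norm_indicatorConstLp (zero_lt_one.trans_le (Fact.out : 1 ≤ p)).ne' hp, norm_one, one_mul,
    one_div, one_div, ENNReal.toReal_inv]

/-- Shadowing one pseudotrajectory, namely `δ s_n T^n 1_W` with jumps of norm `δ`, produces a
primitive of `1 / c` that is `O(1 / c)`, where `c n` is the norm of the indicator function of the
level `f^{-n} W`. -/
theorem exists_primitive_of_hasShadowingProperty (hp : p ≠ ∞) {f : X ≃ᵐ X}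
    (hf : HasBoundedPreimages f μ) (hf' : HasBoundedPreimages f.symm μ)
    (hs : HasShadowingProperty (compositionOperator 𝕜 p f hf hf'))
    {W : Set X} {K : ℝ≥0} (hWm : MeasurableSet W) (hW0 : μ W ≠ 0)
    (hW : μ W ≠ ∞) (hV0 : ∀ n, μ (iterMap f n ⁻¹' W) ≠ 0) (hV : ∀ n, μ (iterMap f n ⁻¹' W) ≠ ∞)
    (hK : ∀ (n : ℤ) (B : Set X), MeasurableSet B → B ⊆ W →
      μ (iterMap f n ⁻¹' W) * μ B ≤ K * (μ (iterMap f n ⁻¹' B) * μ W)) :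
    ∃ (u : ℤ → ℝ) (C : ℝ),
      (∀ n, u (n + 1) - u n = (μ.real (iterMap f (n + 1) ⁻¹' W) ^ (1 / p).toReal)⁻¹) ∧
      ∀ n, |u n| * μ.real (iterMap f n ⁻¹' W) ^ (1 / p).toReal ≤ C := by
  obtain ⟨C, hC⟩ := exists_norm_setIntegral_mul_le 𝕜 p hf hf' hWm hW hV0 hV hK
  have hnorm := norm_zpow_indicatorConstLp 𝕜 p hp hf hf' hWm hW
  set T := compositionOperator 𝕜 p f hf hf' with hT
  set e : Lp 𝕜 p μ := indicatorConstLp p hWm hW (1 : 𝕜) with he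
  set c : ℤ → ℝ := fun n => μ.real (iterMap f n ⁻¹' W) ^ (1 / p).toReal with hc
  have hcpos : ∀ n, 0 < c n := fun n =>
    Real.rpow_pos_of_pos (ENNReal.toReal_pos (hV0 n) (hV n)) _
  have hWpos : 0 < μ.real W := ENNReal.toReal_pos hW0 hW
  obtain ⟨s, hs'⟩ := exists_forward_difference_eq fun n => (c (n + 1))⁻¹
  obtain ⟨δ, hδ, hsh⟩ := hs 1 one_pos
  -- The jump at `n` is `δ (s n - s (n + 1)) T^(n + 1) 1_W`, of norm `δ` by the choice of `s`.
  obtain ⟨y, hy⟩ := hsh (fun n => ((δ * s n : ℝ) : 𝕜) • (T ^ n) e) fun n => by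
    have h1 : (T ^ (n + 1)) e = T ((T ^ n) e) := by
      rw [add_comm, zpow_add, zpow_one]; rfl
    rw [map_smul, ← h1, ← sub_smul, norm_smul, hnorm, ← RCLike.ofReal_sub, RCLike.norm_ofReal,
      ← mul_sub, abs_mul, abs_sub_comm, hs', abs_of_pos hδ, abs_of_pos (inv_pos.2 (hcpos _)),
      mul_assoc]
    exact (mul_le_of_le_one_right hδ.le (inv_mul_cancel₀ (hcpos (n + 1)).ne').le)
  have hC0 : 0 ≤ C := by
    have h := hC 0 e
    rw [hnorm] at h
    exact nonneg_of_mul_nonneg_left ((mul_nonneg (norm_nonneg _) (hcpos 0).le).trans h) (hcpos 0)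
  have hint : ∀ φ : Lp 𝕜 p μ, Integrable φ (μ.restrict W) := fun φ => by
    have : IsFiniteMeasure (μ.restrict W) := ⟨by simpa using hW.lt_top⟩
    exact ((Lp.memLp φ).restrict W).integrable Fact.out
  have hWe : ∫ x in W, e x ∂μ = ((μ.real W : ℝ) : 𝕜) := by
    rw [he, setIntegral_indicatorConstLp hWm, inter_self, RCLike.real_smul_eq_coe_mul, mul_one]
  have hdiff : ∀ n, ∫ x in W, (y - ((δ * s n : ℝ) : 𝕜) • e) x ∂μ
      = (∫ x in W, y x ∂μ) - ((δ * s n * μ.real W : ℝ) : 𝕜) := fun n => by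
    have h1 : ∫ x in W, (y - ((δ * s n : ℝ) : 𝕜) • e) x ∂μ
        = ∫ x in W, (y x - ((δ * s n : ℝ) : 𝕜) * e x) ∂μ := by
      refine integral_congr_ae (ae_restrict_of_ae ?_)
      filter_upwards [Lp.coeFn_sub y (((δ * s n : ℝ) : 𝕜) • e),
        Lp.coeFn_smul ((δ * s n : ℝ) : 𝕜) e] with x h1 h2
      rw [h1, Pi.sub_apply, h2, Pi.smul_apply, smul_eq_mul]
    rw [h1, integral_sub (hint y) ((hint e).const_mul _), integral_const_mul, hWe,
      RCLike.ofReal_mul (δ * s n)]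
  refine ⟨fun n => s n - RCLike.re (∫ x in W, y x ∂μ) / (δ * μ.real W), C / (δ * μ.real W),
    fun n => by rw [sub_sub_sub_cancel_right]; exact hs' n, fun n => ?_⟩
  have hlt : ‖(T ^ n) (y - ((δ * s n : ℝ) : 𝕜) • e)‖ ≤ 1 := by
    rw [map_sub, map_smul]; exact (hy n).le
  have h1 := (hC n (y - ((δ * s n : ℝ) : 𝕜) • e)).trans (mul_le_of_le_one_right hC0 hlt)
  rw [hdiff] at h1
  have h2 := RCLike.abs_re_le_norm ((∫ x in W, y x ∂μ) - ((δ * s n * μ.real W : ℝ) : 𝕜))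
  rw [map_sub, RCLike.ofReal_re] at h2
  have h3 : |s n - RCLike.re (∫ x in W, y x ∂μ) / (δ * μ.real W)|
      = |RCLike.re (∫ x in W, y x ∂μ) - δ * s n * μ.real W| / (δ * μ.real W) := by
    rw [← abs_of_pos (mul_pos hδ hWpos), ← abs_div, abs_of_pos (mul_pos hδ hWpos), abs_sub_comm]
    congr 1
    field_simp
  rw [h3, div_mul_eq_mul_div]
  gcongr
  exact (mul_le_mul_of_nonneg_right h2 (hcpos n).le).trans h1

theorem le_ofReal_rpow_inv_mul_of_toReal_rpow_le {x y : ℝ≥0∞} (hx : x ≠ ∞) (hy : y ≠ ∞)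
    {a s : ℝ} (ha : 0 < a) (hs : 0 ≤ s) (h : x.toReal ^ a ≤ s * y.toReal ^ a) :
    x ≤ ENNReal.ofReal (s ^ a⁻¹) * y := by
  rw [← ENNReal.ofReal_toReal hx, ← ENNReal.ofReal_toReal hy,
    ← ENNReal.ofReal_mul (Real.rpow_nonneg hs _)]
  refine ENNReal.ofReal_le_ofReal ?_
  have h1 := Real.rpow_le_rpow (Real.rpow_nonneg ENNReal.toReal_nonneg _) h (inv_pos.2 ha).le
  rwa [Real.mul_rpow hs (Real.rpow_nonneg ENNReal.toReal_nonneg _),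
    Real.rpow_rpow_inv ENNReal.toReal_nonneg ha.ne',
    Real.rpow_rpow_inv ENNReal.toReal_nonneg ha.ne'] at h1

theorem isGeneralizedHyperbolic_of_hasShadowingProperty (hp : p ≠ ∞) {f : X ≃ᵐ X}
    (hf : HasBoundedPreimages f μ) (hf' : HasBoundedPreimages f.symm μ)
    (hdiss : IsDissipativeOfBoundedDistortion μ f)
    (hs : HasShadowingProperty (compositionOperator 𝕜 p f hf hf')) :
    IsGeneralizedHyperbolic (compositionOperator 𝕜 p f hf hf') := by
  obtain ⟨W, hgen, hdist⟩ := hdiss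
  have hpart := hgen.preimage_partition
  obtain ⟨hWm, hW0', hW', -, -⟩ := hgen
  have hW0 := hW0'.ne'
  have hW := hW'.ne
  obtain ⟨K, hK⟩ := hdist.exists_preimage_bound
  have hVm : ∀ n, MeasurableSet (iterMap f n ⁻¹' W) := fun n => measurable_iterMap f n hWm
  have hV : ∀ n, μ (iterMap f n ⁻¹' W) ≠ ∞ := fun n => by
    obtain ⟨c, -, hc⟩ := hasBoundedPreimages_iterMap hf hf' n
    exact ne_top_of_le_ne_top (ENNReal.mul_ne_top ENNReal.coe_ne_top hW) (hc W hWm)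
  have hV0 : ∀ n, μ (iterMap f n ⁻¹' W) ≠ 0 := fun n h => hW0 <| by
    have := (quasiMeasurePreserving_iterMap hf hf' (-n)).preimage_null h
    rwa [preimage_iterMap_add, add_neg_cancel, iterMap_zero, preimage_id] at this
  set a : ℝ := (1 / p).toReal with ha
  have ha0 : 0 < a := ENNReal.toReal_pos (by simpa using hp)
    (by simpa using (zero_lt_one.trans_le (Fact.out : 1 ≤ p)).ne')
  obtain ⟨u, C, hu, hb⟩ := exists_primitive_of_hasShadowingProperty 𝕜 p hp hf hf' hs hWm hW0 hW hV0
    hV fun n B hB hBW => (hK n B hB hBW).1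
  set c : ℤ → ℝ := fun n => μ.real (iterMap f n ⁻¹' W) ^ a with hc
  have hcpos : ∀ n, 0 < c n := fun n =>
    Real.rpow_pos_of_pos (ENNReal.toReal_pos (hV0 n) (hV n)) _
  obtain ⟨D, hD⟩ : ∃ D : ℝ, ∀ n, c (n + 1) ≤ D * c n := by
    obtain ⟨d, -, hd⟩ := hf
    refine ⟨(d : ℝ) ^ a, fun n => ?_⟩
    have h1 := hd _ (hVm n)
    rw [← iterMap_one, preimage_iterMap_add] at h1
    have h2 := ENNReal.toReal_mono (ENNReal.mul_ne_top ENNReal.coe_ne_top (hV n)) h1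
    rw [ENNReal.toReal_mul, ENNReal.coe_toReal] at h2
    simp only [hc]
    rw [← Real.mul_rpow d.coe_nonneg measureReal_nonneg]
    exact Real.rpow_le_rpow measureReal_nonneg h2 ha0.le
  obtain ⟨C', t, hC', ht0, ht1, hright, hleft⟩ :=
    exists_geometric_bound_of_primitive hcpos hu hb hD
  have hmono : Monotone u := monotone_int_of_le_succ fun n => by
    have := inv_pos.2 (hcpos (n + 1))
    linarith [hu n]
  set I : Set ℤ := {n | 0 ≤ u n} with hI
  set A : Set X := ⋃ n ∈ I, iterMap f n ⁻¹' W with hA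
  have hAc : Aᶜ ⊆ ⋃ n ∈ Iᶜ, iterMap f n ⁻¹' W := fun x hx => by
    obtain ⟨n, hn⟩ := mem_iUnion.1 (hpart.2 ▸ mem_univ x)
    exact mem_iUnion₂.2 ⟨n, fun h => hx (mem_iUnion₂.2 ⟨n, h, hn⟩), hn⟩
  have hAm : MeasurableSet A :=
    MeasurableSet.iUnion fun n => MeasurableSet.iUnion fun _ => hVm n
  -- `I` is an upper set because `u` is increasing.
  have hfA : f ⁻¹' A ⊆ A := fun x hx => by
    obtain ⟨n, hn, hxn⟩ := mem_iUnion₂.1 hx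
    refine mem_iUnion₂.2 ⟨n + 1, (hn : 0 ≤ u n).trans (hmono (by omega)), ?_⟩
    rw [← preimage_iterMap_add, iterMap_one]
    exact hxn
  have hs0 : ∀ k : ℕ, 0 ≤ C' * t ^ k := fun k => by positivity
  refine isGeneralizedHyperbolic_of_geometric_measure_bound 𝕜 p f hf hf' hAm hfA
    (q := fun k => K * K * ENNReal.ofReal ((C' * t ^ k) ^ a⁻¹))
    (C := ((K : ℝ) * K) ^ a * C') ht0 ht1 (fun k => by finiteness) (fun k => ?_)
    (fun k B hB hBA => ?_) fun k B hB hBA => ?_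
  · rw [ENNReal.toReal_mul, ENNReal.toReal_mul, ENNReal.coe_toReal,
      ENNReal.toReal_ofReal (Real.rpow_nonneg (hs0 k) _),
      Real.mul_rpow (by positivity) (Real.rpow_nonneg (hs0 k) _),
      Real.rpow_inv_rpow (hs0 k) ha0.ne', mul_assoc]
  · refine measure_preimage_le_of_subset_iUnion hWm hW0 hW hpart hK (I := I) (fun n hn => ?_) hB hBA
    exact le_ofReal_rpow_inv_mul_of_toReal_rpow_le (hV _) (hV _) ha0 (hs0 k) (hright n hn k)
  · refine measure_preimage_le_of_subset_iUnion hWm hW0 hW hpart hK (I := Iᶜ) (fun n hn => ?_) hB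
      (hBA.trans hAc)
    exact le_ofReal_rpow_inv_mul_of_toReal_rpow_le (hV _) (hV _) ha0 (hs0 k)
      (hleft n (not_le.1 hn) k)

end Shadowing

end Systems

end CompositionDynamics

theorem mainTheorem1 {X : Type*} [MeasurableSpace X] (μ : Measure X) [SigmaFinite μ]
    (f : X ≃ᵐ X)
    (hf : CompositionDynamics.HasBoundedPreimages f μ)
    (hf' : CompositionDynamics.HasBoundedPreimages f.symm μ)
    (hdiss : CompositionDynamics.IsDissipativeOfBoundedDistortion μ f)
    (𝕜 : Type*) [RCLike 𝕜] (p : ℝ≥0∞) [Fact (1 ≤ p)] (hp : p ≠ ∞) :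
    CompositionDynamics.IsGeneralizedHyperbolic
        (CompositionDynamics.compositionOperator 𝕜 p f hf hf') ↔
      CompositionDynamics.HasShadowingProperty
        (CompositionDynamics.compositionOperator 𝕜 p f hf hf') :=
  ⟨fun h => h.hasShadowingProperty,
    CompositionDynamics.isGeneralizedHyperbolic_of_hasShadowingProperty 𝕜 p hp hf hf' hdiss⟩
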